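/- **Proposition 4.** Let $\eta,P_s,N_0,d_1,d_2,\lambda_s,\lambda_d,\lambda_r,T>0$, $0<\alpha<1$, $m\in\mathbb R$, and put $k=\frac{\eta\alpha}{1-\alpha}$. Let $h_1,g,\hat f$ be complex channel coefficients whose gains $|h_1|^2,|g|^2,|\hat f|^2$ are independent exponential random variables with means $\lambda_s,\lambda_d,\lambda_r$ respectively. With single-antenna energy harvesting during a fraction $\alpha$ of the block time $T$ the relay transmits with power $$P_r=\frac{\eta P_s|h_1|^2\,\alpha T}{d_1^m(1-\alpha)T}=\frac{kP_s|h_1|^2}{d_1^m},$$ and in the loopback-interference dominated regime the end-to-end SINR of full-duplex amplify-and-forward relaying is $$\gamma_{\sf AF}=\frac{\frac{P_s|h_1|^2}{P_r|\hat f|^2d_1^md_2^m}\,P_r|g|^2}{\frac{N_0P_s|h_1|^2}{P_r|\hat f|^2d_1^m}+\frac{P_r|g|^2}{d_2^m}+N_0}.$$ Then $\log_2(1+\gamma_{\sf AF})$ is integrable, the integral over $y$ below converges absolutely, and the ergodic capacity $R_{\sf E}^{\sf AF}=\mathbb E\{\log_2(1+\gamma_{\sf AF})\}$ equals $$R_{\sf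 E}^{\sf AF}=\frac{1}{\ln 2}\,G_{4,2}^{1,4}\!\left(\frac{kP_s\lambda_s\lambda_d}{N_0d_1^md_2^m}\,\Big|\,{0,0,1,1\atop 1,0}\right)-\frac{1}{\lambda_r\ln 2}\int_0^\infty G_{4,2}^{1,4}\!\left(\frac{k^2P_s\lambda_s\lambda_d\,y}{N_0d_1^md_2^m(1+ky)}\,\Big|\,{0,0,1,1\atop 1,0}\right)e^{-y/\lambda_r}\,dy,$$ where, for $x>0$, $G_{4,2}^{1,4}$ is the Meijer G-function $$G_{4,2}^{1,4}\!\left(x\,\Big|\,{0,0,1,1\atop 1,0}\right)=\frac{1}{2\pi i}\int_{c-i\infty}^{c+i\infty}\frac{\Gamma(1-s)\,\Gamma(1+s)^2\,\Gamma(s)^2}{\Gamma(1+s)}\,x^{s}\,ds,$$ the integral being absolutely convergent and independent of $c\in(0,1)$. -/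

import Mathlib

noncomputable section

/-- The integrand of the Mellin-Barnes integral of the Meijer G-function `G^{m,n}_{p,q}(z | a; b)`:
`∏_{j ≤ m} Γ(b_j - s) ∏_{j ≤ n} Γ(1 - a_j + s) /
  (∏_{j > m} Γ(1 - b_j + s) ∏_{j > n} Γ(a_j - s)) * z ^ s`.
(The vectors are indexed from `0`, so `j ≤ m` reads `(j : ℕ) < m`; `(Complex.Gamma w)⁻¹` is `0` at
the poles of `Γ`, as it should be for the entire function `1 / Γ`.) -/
def meijerGIntegrand (m n : ℕ) {p q : ℕ} (a : Fin p → ℂ) (b : Fin q → ℂ) (z s : ℂ) : ℂ :=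
  (∏ j : Fin q,
      if (j : ℕ) < m then Complex.Gamma (b j - s) else (Complex.Gamma (1 - b j + s))⁻¹) *
    (∏ j : Fin p,
      if (j : ℕ) < n then Complex.Gamma (1 - a j + s) else (Complex.Gamma (a j - s))⁻¹) *
    z ^ s

/-- The vertical line `Re s = c`, run upwards, has all the poles of `Γ(b_j - s)`, `j ≤ m`, on its
right and all the poles of `Γ(1 - a_j + s)`, `j ≤ n`, on its left. -/
def MeijerGSeparates (m n : ℕ) {p q : ℕ} (a : Fin p → ℂ) (b : Fin q → ℂ) (c : ℝ) : Prop :=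
  (∀ j : Fin q, (j : ℕ) < m → c < (b j).re) ∧ (∀ j : Fin p, (j : ℕ) < n → (a j).re - 1 < c)

/-- `(1 / (2 π i)) ∫ meijerGIntegrand ds` along the line from `c - i ∞` to `c + i ∞`. -/
def meijerGLine (m n : ℕ) {p q : ℕ} (a : Fin p → ℂ) (b : Fin q → ℂ) (z : ℂ) (c : ℝ) : ℂ :=
  (2 * (Real.pi : ℂ) * Complex.I)⁻¹ *
    ∫ t : ℝ, meijerGIntegrand m n a b z ((c : ℂ) + (t : ℂ) * Complex.I) * Complex.I

open Classical in
/-- The Meijer G-function `G^{m,n}_{p,q}(z | a; b)`, for parameters whose two families of poles can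
be separated by a vertical line: the Mellin-Barnes integral along such a line, with the principal
branch of `z ^ s`. -/
def meijerG (m n : ℕ) {p q : ℕ} (a : Fin p → ℂ) (b : Fin q → ℂ) (z : ℂ) : ℂ :=
  if h : ∃ c : ℝ, MeijerGSeparates m n a b c then meijerGLine m n a b z h.choose else 0

/-- The Mellin-Barnes integral that defines `G^{m,n}_{p,q}(z | a; b)` makes sense: there is a
separating vertical line, and along every such line the integral converges absolutely and has the
same value. -/
def MeijerGWellDefined (m n : ℕ) {p q : ℕ} (a : Fin p → ℂ) (b : Fin q → ℂ) (z : ℂ) : Prop :=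
  (∃ c : ℝ, MeijerGSeparates m n a b c) ∧
    ∀ c : ℝ, MeijerGSeparates m n a b c →
      MeasureTheory.Integrable
          (fun t : ℝ => meijerGIntegrand m n a b z ((c : ℂ) + (t : ℂ) * Complex.I)) ∧
        meijerGLine m n a b z c = meijerG m n a b z

/-- Transmit power of the relay when the energy harvested with one antenna during the time `α T`
(channel gain `h = |h₁|²`, conversion efficiency `η`, source power `Ps`, distance `d₁`, path loss
exponent `m`) is spent during the remaining time `(1 - α) T`. -/
def relayPower (η Ps d₁ m α T h : ℝ) : ℝ :=
  η * Ps * h * (α * T) / (d₁ ^ m * ((1 - α) * T))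

/-- End-to-end SINR of full-duplex amplify-and-forward relaying, in the loopback interference
dominated regime, with relay power `Pr`, noise power `N₀` and channel gains `h = |h₁|²`,
`g = |g|²`, `f = |f̂|²` (source-relay, relay-destination, residual loopback). -/
def afSINR (Ps N₀ d₁ d₂ m Pr h g f : ℝ) : ℝ :=
  (Ps * h / (Pr * f * d₁ ^ m * d₂ ^ m) * (Pr * g)) /
    (N₀ * Ps * h / (Pr * f * d₁ ^ m) + Pr * g / d₂ ^ m + N₀)

/-- Instantaneous rate `log₂ (1 + γ)` of full-duplex amplify-and-forward relaying with
single-antenna energy harvesting, as a function of the three channel gains. -/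
def afRate (η Ps N₀ d₁ d₂ m α T h g f : ℝ) : ℝ :=
  Real.logb 2 (1 + afSINR Ps N₀ d₁ d₂ m (relayPower η Ps d₁ m α T h) h g f)

/-- Ergodic capacity: the expectation of the instantaneous rate over the channel coefficients
`h₁`, `g` and `f`. -/
def afErgodicCapacity {Ω : Type*} [MeasurableSpace Ω] (μ : MeasureTheory.Measure Ω)
    (h₁ g f : Ω → ℂ) (η Ps N₀ d₁ d₂ m α T : ℝ) : ℝ :=
  ∫ ω, afRate η Ps N₀ d₁ d₂ m α T (‖h₁ ω‖ ^ 2) (‖g ω‖ ^ 2) (‖f ω‖ ^ 2) ∂μ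

end

/-!
Write `W = A |h₁|² |g|²` with `A = k Pₛ / (N₀ d₁ ^ m d₂ ^ m)`. Inserting the relay power, the
end-to-end SINR satisfies `1 + γ = (1 + W) / (1 + (k f / (1 + k f)) W)` with `f = |f̂|²` (`afRate_eq`), so the rate
is a difference of two terms `log (1 + x U V)` with `U`, `V` independent exponential variables:
`x = A` in the first, `x = A k f / (1 + k f)` in the second.

It therefore suffices to know that the Meijer G-function at `x λₛ λ_d` is the expectation of
`log (1 + x U V)` (`meijerG_eq_integral_log`). This is obtained from inverse Mellin transforms:

* the Mellin transform of `1 / (1 + x)` is `Γ(z) Γ(1 - z)` (write `1 / (1 + x)` as a Laplace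
  integral), it is integrable on the lines `Re z = c` with `0 < c < 1`, and Mellin inversion applies;
* averaging `x ↦ K (x w)` over a random `w` multiplies the Mellin symbol by the moment `E w ^ s`
  (`HasVerticalRep.average`, which is Fubini). Averaging over `w` uniform on `(0, 1]` gives
  `log (1 + x) / x` and the factor `1 / s`; averaging over `w = U V` gives the factors
  `λ ^ s Γ(1 + s)`, one for each exponential variable.

The resulting symbol is the integrand of the Meijer G-function, on every line `Re s = c` with
`0 < c < 1`. Taking the expectation over `f` last yields the formula; integrability everywhere
comes from `0 ≤ log (1 + W) ≤ W`.
-/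

open MeasureTheory Set Filter Topology ProbabilityTheory

/-! ### Functions given by an integral along a vertical line -/

/-- `K` is represented on `(0, ∞)` by the inverse Mellin integral of the symbol `M` along the line
`Re s = c`: `K x = (1 / (2 π i)) ∫ M s x ^ s ds`, with `M` integrable on that line. The kernel is
`x ^ s`, as in the Mellin-Barnes integral of the Meijer G-function, and not `x ^ (-s)` as in
`mellinInv`. -/
structure HasVerticalRep (c : ℝ) (M : ℂ → ℂ) (K : ℝ → ℂ) : Prop where
  integrable : Complex.VerticalIntegrable M c
  eq_integral : ∀ x : ℝ, 0 < x →
    K x = (2 * (Real.pi : ℂ))⁻¹ * ∫ t : ℝ, M (c + t * Complex.I) * (x : ℂ) ^ (c + t * Complex.I : ℂ)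

namespace HasVerticalRep

variable {c : ℝ} {M N : ℂ → ℂ} {K L : ℝ → ℂ}

theorem congr (h : HasVerticalRep c M K) (hMN : ∀ s : ℂ, s.re = c → M s = N s)
    (hKL : ∀ x : ℝ, 0 < x → K x = L x) : HasVerticalRep c N L := by
  have key : ∀ t : ℝ, M (c + t * Complex.I) = N (c + t * Complex.I) :=
    fun t => hMN _ (by simp)
  constructor
  · have := h.integrable
    unfold Complex.VerticalIntegrable at this ⊢
    simpa only [key] using this
  · intro x hx
    rw [← hKL x hx, h.eq_integral x hx]
    simp only [key]

theorem integrable_mul_cpow (h : HasVerticalRep c M K) {x : ℝ} (hx : 0 < x) :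
    Integrable (fun t : ℝ => M (c + t * Complex.I) * (x : ℂ) ^ (c + t * Complex.I : ℂ)) := by
  have h1 : Integrable (fun t : ℝ => M (c + t * Complex.I)) := h.integrable
  refine h1.mul_bdd (c := x ^ c) ?_ (Eventually.of_forall fun t => ?_)
  · refine Continuous.aestronglyMeasurable ?_
    exact Continuous.const_cpow (by fun_prop) (Or.inl (by exact_mod_cast hx.ne'))
  · rw [Complex.norm_cpow_eq_rpow_re_of_pos hx]
    simp

/-- Multiplication by `x` shifts the line by one. -/
theorem self_mul (h : HasVerticalRep (c - 1) M K) :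
    HasVerticalRep c (fun s => M (s - 1)) (fun x => x * K x) := by
  have key : ∀ t : ℝ, (c : ℂ) + t * Complex.I - 1 = ((c - 1 : ℝ) : ℂ) + t * Complex.I := by
    intro t; push_cast; ring
  constructor
  · have := h.integrable
    unfold Complex.VerticalIntegrable at this ⊢
    simpa only [key] using this
  · intro x hx
    have hx' : (x : ℂ) ≠ 0 := by exact_mod_cast hx.ne'
    rw [h.eq_integral x hx, mul_left_comm, ← integral_const_mul]
    congr 2 with t
    simp only [key]
    rw [mul_left_comm, ← key, Complex.cpow_sub _ _ hx', Complex.cpow_one]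
    field_simp

/-- Averaging `x ↦ K (x w)` over `w` multiplies the symbol by the moments of `w`. Since
`|w ^ s| = w ^ c` on the line, integrability of `w ^ c` is all that Fubini's theorem needs. -/
theorem average {Z : Type*} [MeasurableSpace Z] {ν : Measure Z} [SFinite ν] {w : Z → ℝ}
    (h : HasVerticalRep c M K) (hw : Measurable w) (hpos : ∀ᵐ z ∂ν, 0 < w z)
    (hint : Integrable (fun z => w z ^ c) ν) :
    HasVerticalRep c (fun s => M s * ∫ z, (w z : ℂ) ^ s ∂ν) (fun x => ∫ z, K (x * w z) ∂ν) := by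
  have h1 : Integrable (fun t : ℝ => M (c + t * Complex.I)) := h.integrable
  have hmeas : Measurable (fun p : Z × ℝ => ((w p.1 : ℝ) : ℂ) ^ (c + p.2 * Complex.I : ℂ)) := by
    fun_prop
  have hprod : Integrable (fun p : Z × ℝ =>
      ((w p.1 : ℝ) : ℂ) ^ (c + p.2 * Complex.I : ℂ) * M (c + p.2 * Complex.I)) (ν.prod volume) := by
    refine (hint.mul_prod h1.norm).mono' ?_ ?_
    · exact hmeas.aestronglyMeasurable.mul
        (h1.aestronglyMeasurable.comp_quasiMeasurePreserving Measure.quasiMeasurePreserving_snd)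
    · have : ∀ᵐ p ∂(ν.prod (volume : Measure ℝ)), 0 < w p.1 :=
        Measure.quasiMeasurePreserving_fst.ae hpos
      filter_upwards [this] with p hp
      rw [norm_mul, Complex.norm_cpow_eq_rpow_re_of_pos hp]
      simp
  constructor
  · have := hprod.integral_prod_right
    refine this.congr (Eventually.of_forall fun t => ?_)
    simp only [integral_mul_const]
    rw [mul_comm]
  · intro x hx
    have h2 : Integrable (Function.uncurry fun (z : Z) (t : ℝ) => M (c + t * Complex.I) *
        ((x * w z : ℝ) : ℂ) ^ (c + t * Complex.I : ℂ)) (ν.prod volume) := by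
      refine (hprod.mul_bdd (c := x ^ c)
        (g := fun p : Z × ℝ => (x : ℂ) ^ (c + p.2 * Complex.I : ℂ)) ?_
        (Eventually.of_forall fun p => ?_)).congr ?_
      · exact (by fun_prop : Measurable
          (fun p : Z × ℝ => (x : ℂ) ^ (c + p.2 * Complex.I : ℂ))).aestronglyMeasurable
      · rw [Complex.norm_cpow_eq_rpow_re_of_pos hx]
        simp
      · have : ∀ᵐ p ∂(ν.prod (volume : Measure ℝ)), 0 < w p.1 :=
          Measure.quasiMeasurePreserving_fst.ae hpos
        filter_upwards [this] with p hp
        simp only [Function.uncurry]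
        rw [Complex.ofReal_mul, Complex.mul_cpow_ofReal_nonneg hx.le hp.le]
        ring
    have h3 : ∫ z, K (x * w z) ∂ν = ∫ z, (2 * (Real.pi : ℂ))⁻¹ * (∫ t : ℝ, M (c + t * Complex.I) *
        ((x * w z : ℝ) : ℂ) ^ (c + t * Complex.I : ℂ)) ∂ν := by
      refine integral_congr_ae ?_
      filter_upwards [hpos] with z hz
      exact h.eq_integral _ (mul_pos hx hz)
    rw [h3, integral_const_mul, integral_integral_swap h2]
    congr 2 with t
    rw [integral_const_mul, mul_assoc, ← integral_mul_const]
    congr 1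
    refine integral_congr_ae ?_
    filter_upwards [hpos] with z hz
    rw [Complex.ofReal_mul, Complex.mul_cpow_ofReal_nonneg hx.le hz.le, mul_comm]

end HasVerticalRep

/-! ### The Mellin transform of `1 / (1 + x)` and its inversion -/

theorem mellinConvergent_one_add_inv {z : ℂ} (h0 : 0 < z.re) (h1 : z.re < 1) :
    MellinConvergent (fun x : ℝ => (((1 + x)⁻¹ : ℝ) : ℂ)) z := by
  refine mellinConvergent_of_isBigO_rpow (a := 1) (b := 0) ?_ ?_ h1 ?_ h0
  · refine ContinuousOn.locallyIntegrableOn ?_ measurableSet_Ioi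
    refine Complex.continuous_ofReal.comp_continuousOn ?_
    refine ContinuousOn.inv₀ (by fun_prop) fun x hx => ?_
    have : (0 : ℝ) < x := hx
    positivity
  · refine Asymptotics.IsBigO.of_bound 1 ?_
    filter_upwards [eventually_gt_atTop 0] with x hx
    rw [Complex.norm_real, Real.norm_of_nonneg (by positivity), Real.rpow_neg_one,
      Real.norm_of_nonneg (by positivity), one_mul]
    gcongr
    linarith
  · refine Asymptotics.IsBigO.of_bound 1 ?_
    filter_upwards [self_mem_nhdsWithin] with x hx
    have hx' : (0 : ℝ) < x := hx
    rw [Complex.norm_real, Real.norm_of_nonneg (by positivity)]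
    simp only [neg_zero, Real.rpow_zero, norm_one, mul_one]
    exact inv_le_one_of_one_le₀ (by linarith)

/-- Exchange the integrals after `1 / (1 + x) = ∫ exp (-(1 + x) r) dr`. -/
theorem mellin_one_add_inv {z : ℂ} (h0 : 0 < z.re) (h1 : z.re < 1) :
    mellin (fun x : ℝ => (((1 + x)⁻¹ : ℝ) : ℂ)) z =
      Complex.Gamma z * Complex.Gamma (1 - z) := by
  have hexp : ∀ x : ℝ, 0 < x → ∫ r in Ioi (0 : ℝ), Real.exp (-((1 + x) * r)) = (1 + x)⁻¹ := by
    intro x hx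
    have := integral_exp_mul_Ioi (a := -(1 + x)) (by linarith) 0
    simp only [neg_mul] at this
    rw [this, mul_zero, neg_zero, Real.exp_zero, neg_div_neg_eq, one_div]
  have hexpi : ∀ x : ℝ, 0 < x →
      IntegrableOn (fun r : ℝ => Real.exp (-((1 + x) * r))) (Ioi (0 : ℝ)) := by
    intro x hx
    have := exp_neg_integrableOn_Ioi 0 (b := 1 + x) (by linarith)
    simpa only [neg_mul] using this
  have hprod : Integrable (Function.uncurry fun (x r : ℝ) =>
      (x : ℂ) ^ (z - 1) * ((Real.exp (-((1 + x) * r)) : ℝ) : ℂ))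
      ((volume.restrict (Ioi 0)).prod (volume.restrict (Ioi 0))) := by
    rw [integrable_prod_iff]
    · constructor
      · filter_upwards [ae_restrict_mem measurableSet_Ioi] with x hx
        exact Integrable.const_mul (𝕜 := ℂ) (hexpi x hx).ofReal ((x : ℂ) ^ (z - 1))
      · refine (mellinConvergent_one_add_inv h0 h1).norm.congr ?_
        filter_upwards [ae_restrict_mem measurableSet_Ioi] with x hx
        have hx' : (0 : ℝ) < x := hx
        simp only [Function.uncurry, norm_mul, norm_smul, Complex.norm_real, Real.norm_eq_abs,
          Real.abs_exp]
        rw [integral_const_mul, hexp x hx, abs_of_pos (by positivity)]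
    · refine Measurable.aestronglyMeasurable ?_
      unfold Function.uncurry
      fun_prop
  have hz : 0 < (1 - z).re := by simp; linarith
  calc mellin (fun x : ℝ => (((1 + x)⁻¹ : ℝ) : ℂ)) z
      = ∫ x in Ioi (0 : ℝ), ∫ r in Ioi (0 : ℝ),
          (x : ℂ) ^ (z - 1) * ((Real.exp (-((1 + x) * r)) : ℝ) : ℂ) := by
        refine setIntegral_congr_fun measurableSet_Ioi fun x hx => ?_
        simp only [smul_eq_mul]
        rw [integral_const_mul, integral_complex_ofReal, hexp x hx]
    _ = ∫ r in Ioi (0 : ℝ), ∫ x in Ioi (0 : ℝ),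
          (x : ℂ) ^ (z - 1) * ((Real.exp (-((1 + x) * r)) : ℝ) : ℂ) := integral_integral_swap hprod
    _ = ∫ r in Ioi (0 : ℝ), Complex.Gamma z *
          (((Real.exp (-r) : ℝ) : ℂ) * (r : ℂ) ^ ((1 - z) - 1)) := by
        refine setIntegral_congr_fun measurableSet_Ioi fun r hr => ?_
        have hr' : (0 : ℝ) < r := hr
        have h2 := Complex.integral_cpow_mul_exp_neg_mul_Ioi h0 hr'
        have h3 : ∀ x : ℝ, (x : ℂ) ^ (z - 1) * ((Real.exp (-((1 + x) * r)) : ℝ) : ℂ) =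
            ((Real.exp (-r) : ℝ) : ℂ) * ((x : ℂ) ^ (z - 1) * Complex.exp (-(r * x))) := by
          intro x
          push_cast
          rw [mul_left_comm, ← Complex.exp_add]
          congr 2; ring
        simp only [h3]
        rw [integral_const_mul, h2]
        have h4 : (1 / (r : ℂ)) ^ z = (r : ℂ) ^ ((1 - z) - 1) := by
          rw [one_div, Complex.inv_cpow _ _ (by
            rw [Complex.arg_ofReal_of_nonneg hr'.le]; exact Real.pi_pos.ne), ← Complex.cpow_neg]
          congr 1; ring
        rw [h4]; ring
    _ = Complex.Gamma z * Complex.Gamma (1 - z) := by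
        rw [integral_const_mul, Complex.Gamma_eq_integral hz]; rfl

/-- By the reflection formula the product is `π / sin (π s)`, and on the line `Re s = c`
`|sin (π s)| ≥ |Re sin (π s)| = sin (π c) cosh (π t) ≥ sin (π c) (1 + t²)`. -/
theorem verticalIntegrable_Gamma_mul_Gamma_one_sub {c : ℝ} (h0 : 0 < c) (h1 : c < 1) :
    Complex.VerticalIntegrable (fun s => Complex.Gamma s * Complex.Gamma (1 - s)) c := by
  have hsin : 0 < Real.sin (Real.pi * c) :=
    Real.sin_pos_of_pos_of_lt_pi (by positivity) (by nlinarith [Real.pi_pos])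
  have hnorm : ∀ t : ℝ, Real.sin (Real.pi * c) * (1 + t ^ 2) ≤
      ‖Complex.sin (Real.pi * (c + t * Complex.I))‖ := by
    intro t
    have hsinh : ∀ y : ℝ, y ^ 2 ≤ Real.sinh y ^ 2 := fun y => by
      rcases le_total 0 y with hy | hy
      · exact pow_le_pow_left₀ hy (Real.self_le_sinh_iff.2 hy) 2
      · have := pow_le_pow_left₀ (neg_nonneg.2 hy) (Real.self_le_sinh_iff.2 (neg_nonneg.2 hy)) 2
        rwa [Real.sinh_neg, neg_sq, neg_sq] at this
    have hcosh : 1 + t ^ 2 ≤ Real.cosh (Real.pi * t) := by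
      have h2 : Real.cosh (Real.pi * t) = 1 + 2 * Real.sinh (Real.pi * t / 2) ^ 2 := by
        rw [show Real.pi * t = 2 * (Real.pi * t / 2) by ring, Real.cosh_two_mul, Real.cosh_sq]
        ring_nf
      have h3 := hsinh (Real.pi * t / 2)
      nlinarith [sq_nonneg t, Real.pi_gt_three, mul_nonneg (sq_nonneg t) (sq_nonneg (Real.pi - 3))]
    refine le_trans (mul_le_mul_of_nonneg_left hcosh hsin.le) ?_
    have hre : (Complex.sin (Real.pi * (c + t * Complex.I))).re =
        Real.sin (Real.pi * c) * Real.cosh (Real.pi * t) := by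
      rw [show (Real.pi : ℂ) * (c + t * Complex.I) =
        ((Real.pi * c : ℝ) : ℂ) + ((Real.pi * t : ℝ) : ℂ) * Complex.I by push_cast; ring,
        Complex.sin_add_mul_I, ← Complex.ofReal_sin, ← Complex.ofReal_cosh, ← Complex.ofReal_cos,
        ← Complex.ofReal_sinh, ← Complex.ofReal_mul, ← Complex.ofReal_mul]
      simp only [Complex.add_re, Complex.ofReal_re, Complex.re_ofReal_mul, Complex.I_re, mul_zero,
        add_zero]
    rw [← hre]
    exact Complex.re_le_norm _
  have hne : ∀ t : ℝ, Complex.sin (Real.pi * (c + t * Complex.I)) ≠ 0 := fun t => by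
    rw [← norm_pos_iff]
    exact lt_of_lt_of_le (by positivity) (hnorm t)
  unfold Complex.VerticalIntegrable
  simp only [Complex.Gamma_mul_Gamma_one_sub]
  refine (integrable_inv_one_add_sq.const_mul (Real.pi / Real.sin (Real.pi * c))).mono' ?_ ?_
  · refine Continuous.aestronglyMeasurable ?_
    exact Continuous.div (by fun_prop) (by fun_prop) hne
  · refine Eventually.of_forall fun t => ?_
    rw [norm_div, Complex.norm_real, Real.norm_of_nonneg Real.pi_pos.le, ← div_eq_mul_inv, div_div]
    have := hnorm t
    gcongr

theorem hasVerticalRep_one_add_inv {c : ℝ} (h0 : 0 < c) (h1 : c < 1) :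
    HasVerticalRep (c - 1) (fun s => Complex.Gamma (-s) * Complex.Gamma (1 + s))
      (fun x => (((1 + x)⁻¹ : ℝ) : ℂ)) := by
  have hre : ∀ t : ℝ, (((1 - c : ℝ) : ℂ) + t * Complex.I).re = 1 - c := fun t => by simp
  have hmel : ∀ t : ℝ,
      mellin (fun x : ℝ => (((1 + x)⁻¹ : ℝ) : ℂ)) (((1 - c : ℝ) : ℂ) + t * Complex.I)
      = Complex.Gamma (((1 - c : ℝ) : ℂ) + t * Complex.I) *
        Complex.Gamma (1 - (((1 - c : ℝ) : ℂ) + t * Complex.I)) := fun t =>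
    mellin_one_add_inv (by rw [hre]; linarith) (by rw [hre]; linarith)
  have hv := verticalIntegrable_Gamma_mul_Gamma_one_sub (c := 1 - c) (by linarith) (by linarith)
  have hneg : ∀ t : ℝ, (((1 - c : ℝ) : ℂ) + ((-t : ℝ) : ℂ) * Complex.I) =
      -(((c - 1 : ℝ) : ℂ) + t * Complex.I) := fun t => by push_cast; ring
  constructor
  · have h2 : Integrable (fun t : ℝ => _) := Integrable.comp_neg hv
    refine h2.congr (Eventually.of_forall fun t => ?_)
    simp only [hneg, sub_neg_eq_add]
  · intro x hx
    -- Mathlib inverts along `Re z = 1 - c` with the kernel `x ^ (-z)`; put `s = -z`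
    have h3 := mellinInv_mellin_eq (1 - c) (fun x : ℝ => (((1 + x)⁻¹ : ℝ) : ℂ)) hx
      (mellinConvergent_one_add_inv (by simpa using h1) (by simpa using h0))
      (by
        unfold Complex.VerticalIntegrable at hv ⊢
        simpa only [hmel] using hv)
      (Complex.continuous_ofReal.continuousAt.comp
        (ContinuousAt.inv₀ (by fun_prop) (by positivity)))
    rw [← h3, mellinInv, ← integral_neg_eq_self]
    simp only [hmel]
    simp only [hneg, sub_neg_eq_add, neg_neg, smul_eq_mul, Complex.real_smul]
    push_cast
    rw [one_div]
    congr 2 with t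
    rw [mul_comm]

/-! ### The logarithm -/

theorem integral_one_add_mul_inv {x : ℝ} (hx : 0 < x) :
    ∫ r in Ioc (0 : ℝ) 1, (1 + x * r)⁻¹ = Real.log (1 + x) / x := by
  have hpos : ∀ r ∈ uIcc (0 : ℝ) 1, 0 < 1 + x * r := fun r hr => by
    rw [uIcc_of_le zero_le_one] at hr
    have := mul_nonneg hx.le hr.1
    linarith
  rw [← intervalIntegral.integral_of_le zero_le_one,
    intervalIntegral.integral_eq_sub_of_hasDerivAt (f := fun r => Real.log (1 + x * r) / x)]
  · simp
  · intro r hr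
    have h1 : HasDerivAt (fun r => 1 + x * r) x r := by
      simpa using ((hasDerivAt_id r).const_mul x).const_add 1
    exact ((h1.log (hpos r hr).ne').div_const x).congr_deriv
      (by rw [div_right_comm, div_self hx.ne', one_div])
  · refine ContinuousOn.intervalIntegrable ?_
    exact ContinuousOn.inv₀ (by fun_prop) fun r hr => (hpos r hr).ne'

/-- Average `1 / (1 + x r)` over `r ∈ (0, 1]`, where `∫ r ^ (s - 1) dr = 1 / s`, and multiply by `x`. -/
theorem hasVerticalRep_log_one_add {c : ℝ} (h0 : 0 < c) (h1 : c < 1) :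
    HasVerticalRep c (fun s => Complex.Gamma s * Complex.Gamma (1 - s) / s)
      (fun x => ((Real.log (1 + x) : ℝ) : ℂ)) := by
  have h := (hasVerticalRep_one_add_inv h0 h1).average (Z := ℝ)
    (ν := volume.restrict (Ioc (0 : ℝ) 1)) (w := id) measurable_id
    ((ae_restrict_mem measurableSet_Ioc).mono fun r hr => hr.1)
    ((intervalIntegrable_iff_integrableOn_Ioc_of_le zero_le_one).1
      (intervalIntegral.intervalIntegrable_rpow' (by linarith)))
  refine h.self_mul.congr (fun s hs => ?_) fun x hx => ?_
  · have h2 : ∫ r in Ioc (0 : ℝ) 1, ((id r : ℝ) : ℂ) ^ (s - 1) = 1 / s := by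
      have hs0 : s ≠ 0 := fun h => by rw [h] at hs; simp at hs; linarith
      simp only [id]
      rw [← intervalIntegral.integral_of_le zero_le_one,
        integral_cpow (Or.inl (by simp [hs]; linarith))]
      simp [hs0]
    rw [h2, neg_sub, add_sub_cancel]
    ring
  · simp only [id]
    rw [integral_complex_ofReal, integral_one_add_mul_inv hx, ← Complex.ofReal_mul,
      mul_div_cancel₀ _ hx.ne']

/-! ### Integrals and moments of the exponential distribution -/

theorem expMeasure_eq_withDensity (r : ℝ) :
    expMeasure r = (volume.restrict (Ioi 0)).withDensity
      fun x => ENNReal.ofReal (r * Real.exp (-(r * x))) := by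
  have h : expMeasure r = volume.withDensity (exponentialPDF r) := rfl
  rw [h, ← withDensity_indicator measurableSet_Ioi]
  refine withDensity_congr_ae ?_
  have h0 : ∀ᵐ x : ℝ, x ≠ 0 := by simp [ae_iff]
  filter_upwards [h0] with x hx
  rw [exponentialPDF_eq]
  rcases lt_or_gt_of_ne hx with hx | hx
  · rw [if_neg (not_le.2 hx), indicator_of_notMem (by simpa using hx.le)]
    simp
  · rw [if_pos hx.le, indicator_of_mem (by simpa using hx)]

theorem ae_expMeasure_pos (r : ℝ) : ∀ᵐ x ∂(expMeasure r), 0 < x := by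
  rw [expMeasure_eq_withDensity]
  exact (withDensity_absolutelyContinuous _ _).ae_le (ae_restrict_mem measurableSet_Ioi)

section

variable {E : Type*} [NormedAddCommGroup E] [NormedSpace ℝ E]

theorem integrable_expMeasure_iff {r : ℝ} (hr : 0 ≤ r) {u : ℝ → E} :
    Integrable u (expMeasure r) ↔
      IntegrableOn (fun x => (r * Real.exp (-(r * x))) • u x) (Ioi 0) := by
  rw [expMeasure_eq_withDensity, integrable_withDensity_iff_integrable_smul' (by fun_prop)
    (by simp), IntegrableOn]
  simp only [ENNReal.toReal_ofReal (mul_nonneg hr (Real.exp_pos _).le)]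

theorem integral_expMeasure {r : ℝ} (hr : 0 ≤ r) (u : ℝ → E) :
    ∫ x, u x ∂(expMeasure r) = ∫ x in Ioi (0 : ℝ), (r * Real.exp (-(r * x))) • u x := by
  rw [expMeasure_eq_withDensity, integral_withDensity_eq_integral_toReal_smul (by fun_prop)
    (by simp)]
  simp only [ENNReal.toReal_ofReal (mul_nonneg hr (Real.exp_pos _).le)]

end

theorem integrable_rpow_expMeasure {r : ℝ} (hr : 0 < r) {c : ℝ} (hc : 0 ≤ c) :
    Integrable (fun x => x ^ c) (expMeasure r) := by
  rw [integrable_expMeasure_iff hr.le]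
  refine IntegrableOn.congr_fun
    (Integrable.const_mul (integrableOn_rpow_mul_exp_neg_mul_rpow (s := c) (p := 1)
      (by linarith) one_pos hr) r) (fun x _ => ?_) measurableSet_Ioi
  simp only [Real.rpow_one, smul_eq_mul]
  ring_nf

/-- The complex moments of the exponential distribution with mean `l`. -/
theorem integral_cpow_expMeasure {l : ℝ} (hl : 0 < l) {s : ℂ} (hs : -1 < s.re) :
    ∫ x, (x : ℂ) ^ s ∂(expMeasure (1 / l)) = (l : ℂ) ^ s * Complex.Gamma (1 + s) := by
  have hr : 0 < 1 / l := by positivity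
  have hl' : (l : ℂ) ≠ 0 := by exact_mod_cast hl.ne'
  rw [integral_expMeasure hr.le]
  have h := Complex.integral_cpow_mul_exp_neg_mul_Ioi (a := 1 + s) (by simp; linarith) hr
  have h2 : ∀ x : ℝ, (1 / l * Real.exp (-(1 / l * x))) • (x : ℂ) ^ s =
      (1 / l : ℂ) * ((x : ℂ) ^ (1 + s - 1) * Complex.exp (-(((1 / l : ℝ) : ℂ) * x))) := by
    intro x
    rw [Complex.real_smul, add_sub_cancel_left]
    push_cast
    ring
  simp only [h2]
  rw [integral_const_mul, h]
  push_cast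
  rw [one_div_one_div, Complex.cpow_add _ _ hl', Complex.cpow_one]
  field_simp

/-- Since `0 ≤ log (1 + w) ≤ w`. -/
theorem integrable_log_one_add {Z : Type*} [MeasurableSpace Z] {ν : Measure Z} {w : Z → ℝ}
    (hw : Integrable w ν) (h0 : ∀ᵐ z ∂ν, 0 ≤ w z) : Integrable (fun z => Real.log (1 + w z)) ν := by
  refine hw.mono' ?_ ?_
  · exact (Real.measurable_log.comp_aemeasurable (hw.aemeasurable.const_add 1)).aestronglyMeasurable
  · filter_upwards [h0] with z hz
    rw [Real.norm_of_nonneg (Real.log_nonneg (by linarith))]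
    linarith [Real.log_le_sub_one_of_pos (show 0 < 1 + w z by linarith)]

theorem ae_prod_expMeasure_pos (a b : ℝ) [SFinite (expMeasure a)] [SFinite (expMeasure b)] :
    ∀ᵐ p ∂((expMeasure a).prod (expMeasure b)), 0 < p.1 ∧ 0 < p.2 :=
  (Measure.quasiMeasurePreserving_fst.ae (ae_expMeasure_pos a)).and
    (Measure.quasiMeasurePreserving_snd.ae (ae_expMeasure_pos b))

/-- The expectation of `log (1 + x U V)`, for `U`, `V` independent and exponential with means `l₁`,
`l₂`. The factor `1 / s` of the symbol of the logarithm turns one of the two `Γ(1 + s)` contributed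
by the moments into `Γ(s)`. -/
theorem hasVerticalRep_integral_log {l₁ l₂ c : ℝ} (hl₁ : 0 < l₁) (hl₂ : 0 < l₂)
    (h0 : 0 < c) (h1 : c < 1) :
    HasVerticalRep c
      (fun s => Complex.Gamma (1 - s) * Complex.Gamma (1 + s) * Complex.Gamma s ^ 2 *
        ((l₁ * l₂ : ℝ) : ℂ) ^ s)
      (fun x => ((∫ p, Real.log (1 + x * (p.1 * p.2))
        ∂((expMeasure (1 / l₁)).prod (expMeasure (1 / l₂))) : ℝ) : ℂ)) := by
  have := isProbabilityMeasure_expMeasure (one_div_pos.2 hl₁)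
  have := isProbabilityMeasure_expMeasure (one_div_pos.2 hl₂)
  have hpos := ae_prod_expMeasure_pos (1 / l₁) (1 / l₂)
  have h := (hasVerticalRep_log_one_add h0 h1).average (w := fun p : ℝ × ℝ => p.1 * p.2)
    (ν := (expMeasure (1 / l₁)).prod (expMeasure (1 / l₂))) (by fun_prop)
    (hpos.mono fun p hp => mul_pos hp.1 hp.2)
    (((integrable_rpow_expMeasure (one_div_pos.2 hl₁) h0.le).mul_prod
      (integrable_rpow_expMeasure (one_div_pos.2 hl₂) h0.le)).congr
      (hpos.mono fun p hp => (Real.mul_rpow hp.1.le hp.2.le).symm))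
  refine h.congr (fun s hs => ?_) fun x hx => integral_complex_ofReal
  have hs0 : s ≠ 0 := fun h => by rw [h] at hs; simp at hs; linarith
  have h2 : ∫ p, ((p.1 * p.2 : ℝ) : ℂ) ^ s ∂((expMeasure (1 / l₁)).prod (expMeasure (1 / l₂))) =
      ((l₁ : ℂ) ^ s * Complex.Gamma (1 + s)) * ((l₂ : ℂ) ^ s * Complex.Gamma (1 + s)) := by
    rw [← integral_cpow_expMeasure hl₁ (by linarith), ← integral_cpow_expMeasure hl₂ (by linarith),
      ← integral_prod_mul]
    refine integral_congr_ae (hpos.mono fun p hp => ?_)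
    simp only
    rw [Complex.ofReal_mul, Complex.mul_cpow_ofReal_nonneg hp.1.le hp.2.le]
  rw [h2, Complex.ofReal_mul, Complex.mul_cpow_ofReal_nonneg hl₁.le hl₂.le, add_comm 1 s,
    Complex.Gamma_add_one s hs0]
  field_simp

/-! ### The Meijer G-function as an expectation -/

/-- To the right of the imaginary axis one factor `Γ(1 + s)` cancels against the denominator. -/
theorem meijerGIntegrand_eq_of_re_pos (z s : ℂ) (hs : 0 < s.re) :
    meijerGIntegrand 1 4 ![0, 0, 1, 1] ![1, 0] z s =
      Complex.Gamma (1 - s) * Complex.Gamma (1 + s) * Complex.Gamma s ^ 2 * z ^ s := by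
  have hne : Complex.Gamma (1 + s) ≠ 0 := Complex.Gamma_ne_zero_of_re_pos (by simp; linarith)
  simp [meijerGIntegrand, Fin.prod_univ_succ]
  left
  field_simp

theorem meijerGSeparates_iff (c : ℝ) :
    MeijerGSeparates 1 4 (![0, 0, 1, 1] : Fin 4 → ℂ) ![1, 0] c ↔ 0 < c ∧ c < 1 := by
  constructor
  · rintro ⟨h1, h2⟩
    exact ⟨by simpa using h2 2 (by decide), by simpa using h1 0 (by decide)⟩
  · rintro ⟨h0, h1⟩
    constructor
    · intro j hj
      fin_cases j <;> simp_all
    · intro j hj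
      fin_cases j <;> simp <;> linarith

theorem integrable_meijerGIntegrand {x c : ℝ} (hx : 0 < x) (h0 : 0 < c) (h1 : c < 1) :
    Integrable (fun t : ℝ =>
      meijerGIntegrand 1 4 ![0, 0, 1, 1] ![1, 0] (x : ℂ) (c + t * Complex.I)) := by
  have h := (hasVerticalRep_integral_log one_pos one_pos h0 h1).integrable_mul_cpow hx
  refine h.congr (Eventually.of_forall fun t => ?_)
  simp only
  rw [meijerGIntegrand_eq_of_re_pos _ _ (by simpa using h0)]
  simp

theorem meijerGLine_eq_integral_log {x l₁ l₂ c : ℝ} (hx : 0 < x) (hl₁ : 0 < l₁) (hl₂ : 0 < l₂)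
    (h0 : 0 < c) (h1 : c < 1) :
    meijerGLine 1 4 ![0, 0, 1, 1] ![1, 0] ((x * l₁ * l₂ : ℝ) : ℂ) c =
      ((∫ p, Real.log (1 + x * (p.1 * p.2))
        ∂((expMeasure (1 / l₁)).prod (expMeasure (1 / l₂))) : ℝ) : ℂ) := by
  have hI : ∀ J : ℂ, (2 * (Real.pi : ℂ) * Complex.I)⁻¹ * (J * Complex.I) =
      (2 * (Real.pi : ℂ))⁻¹ * J := fun J => by
    rw [mul_inv, mul_comm J, mul_assoc, inv_mul_cancel_left₀ Complex.I_ne_zero]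
  rw [(hasVerticalRep_integral_log hl₁ hl₂ h0 h1).eq_integral x hx, meijerGLine,
    integral_mul_const, hI]
  congr 2 with t
  rw [meijerGIntegrand_eq_of_re_pos _ _ (by simpa using h0), mul_assoc x, mul_comm x,
    Complex.ofReal_mul _ x, Complex.mul_cpow_ofReal_nonneg (mul_pos hl₁ hl₂).le hx.le]
  ring

/-- `E log (1 + x U V)` for independent exponential `U`, `V` with means `l₁`, `l₂`. -/
theorem meijerG_eq_integral_log {x l₁ l₂ : ℝ} (hx : 0 < x) (hl₁ : 0 < l₁) (hl₂ : 0 < l₂) :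
    meijerG 1 4 ![0, 0, 1, 1] ![1, 0] ((x * l₁ * l₂ : ℝ) : ℂ) =
      ((∫ p, Real.log (1 + x * (p.1 * p.2))
        ∂((expMeasure (1 / l₁)).prod (expMeasure (1 / l₂))) : ℝ) : ℂ) := by
  have h : ∃ c : ℝ, MeijerGSeparates 1 4 (![0, 0, 1, 1] : Fin 4 → ℂ) ![1, 0] c :=
    ⟨1 / 2, (meijerGSeparates_iff _).2 (by norm_num)⟩
  rw [meijerG, dif_pos h]
  have hc := (meijerGSeparates_iff _).1 h.choose_spec
  exact meijerGLine_eq_integral_log hx hl₁ hl₂ hc.1 hc.2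

/-- On every admissible line the integral is the same expectation, with both means equal to `1`. -/
theorem meijerGWellDefined {x : ℝ} (hx : 0 < x) :
    MeijerGWellDefined 1 4 ![0, 0, 1, 1] ![1, 0] (x : ℂ) := by
  refine ⟨⟨1 / 2, (meijerGSeparates_iff _).2 (by norm_num)⟩, fun c hc => ?_⟩
  obtain ⟨h0, h1⟩ := (meijerGSeparates_iff c).1 hc
  refine ⟨integrable_meijerGIntegrand hx h0 h1, ?_⟩
  have h2 := meijerGLine_eq_integral_log hx one_pos one_pos h0 h1
  rw [← meijerG_eq_integral_log hx one_pos one_pos, mul_one, mul_one] at h2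
  exact h2

/-! ### The rate of amplify-and-forward relaying -/

/-- The rate splits into two logarithms. Positive gains are needed: at a zero gain the SINR contains
divisions by zero. -/
theorem afRate_eq {η Ps N₀ d₁ d₂ m α T h g f : ℝ}
    (hη : 0 < η) (hPs : 0 < Ps) (hN₀ : 0 < N₀) (hd₁ : 0 < d₁) (hd₂ : 0 < d₂)
    (hα₀ : 0 < α) (hα₁ : α < 1) (hT : 0 < T) (hh : 0 < h) (hg : 0 < g) (hf : 0 < f)
    {k A : ℝ} (hk : k = η * α / (1 - α)) (hA : A = k * Ps / (N₀ * d₁ ^ m * d₂ ^ m)) :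
    afRate η Ps N₀ d₁ d₂ m α T h g f =
      (Real.log (1 + A * (h * g)) - Real.log (1 + A * (k * f / (1 + k * f)) * (h * g))) /
        Real.log 2 := by
  have h1α : 0 < 1 - α := by linarith
  have hk0 : 0 < k := by rw [hk]; positivity
  have hD₁ : 0 < d₁ ^ m := Real.rpow_pos_of_pos hd₁ m
  have hD₂ : 0 < d₂ ^ m := Real.rpow_pos_of_pos hd₂ m
  have hA0 : 0 < A := by rw [hA]; positivity
  have hPr : relayPower η Ps d₁ m α T h = k * Ps * h / d₁ ^ m := by
    rw [relayPower, hk]; field_simp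
  rw [afRate, Real.logb, ← Real.log_div (by positivity) (by positivity)]
  congr 2
  rw [hPr, afSINR, hA]
  generalize d₁ ^ m = D₁ at *
  generalize d₂ ^ m = D₂ at *
  clear hk hA hPr
  field_simp
  ring

theorem map_triple_eq_prod_of_iIndepFun {Ω : Type*} [MeasurableSpace Ω] {μ : Measure Ω}
    [IsProbabilityMeasure μ] {X Y Z : Ω → ℝ} (hX : Measurable X) (hY : Measurable Y) (hZ : Measurable Z)
    (h : iIndepFun ![X, Y, Z] μ) :
    μ.map (fun ω => ((X ω, Y ω), Z ω)) = ((μ.map X).prod (μ.map Y)).prod (μ.map Z) := by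
  have hm : ∀ i, Measurable ((![X, Y, Z] : Fin 3 → Ω → ℝ) i) := by
    intro i; fin_cases i <;> assumption
  have h1 : IndepFun (fun ω => (X ω, Y ω)) Z μ :=
    h.indepFun_prodMk hm 0 1 2 (by decide) (by decide)
  have h2 : IndepFun X Y μ := h.indepFun (i := 0) (j := 1) (by decide)
  rw [← h2.map_prod_eq_prod_map_map hX.aemeasurable hY.aemeasurable,
    ← h1.map_prod_eq_prod_map_map (hX.prodMk hY).aemeasurable hZ.aemeasurable]

theorem proposition4 {Ω : Type*} [MeasurableSpace Ω] (μ : MeasureTheory.Measure Ω)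
    [MeasureTheory.IsProbabilityMeasure μ]
    (h₁ g f : Ω → ℂ) (hh₁ : Measurable h₁) (hg : Measurable g) (hf : Measurable f)
    (η Ps N₀ d₁ d₂ m α T ls ld lr k : ℝ)
    (hη : 0 < η) (hPs : 0 < Ps) (hN₀ : 0 < N₀) (hd₁ : 0 < d₁) (hd₂ : 0 < d₂)
    (hα₀ : 0 < α) (hα₁ : α < 1) (hT : 0 < T) (hls : 0 < ls) (hld : 0 < ld) (hlr : 0 < lr)
    (hk : k = η * α / (1 - α))
    (law_h₁ : μ.map (fun ω => ‖h₁ ω‖ ^ 2) = ProbabilityTheory.expMeasure (1 / ls))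
    (law_g : μ.map (fun ω => ‖g ω‖ ^ 2) = ProbabilityTheory.expMeasure (1 / ld))
    (law_f : μ.map (fun ω => ‖f ω‖ ^ 2) = ProbabilityTheory.expMeasure (1 / lr))
    (indep : ProbabilityTheory.iIndepFun
      ![fun ω => ‖h₁ ω‖ ^ 2, fun ω => ‖g ω‖ ^ 2, fun ω => ‖f ω‖ ^ 2] μ) :
    (∀ x : ℝ, 0 < x → MeijerGWellDefined 1 4 ![0, 0, 1, 1] ![1, 0] (x : ℂ)) ∧
    MeasureTheory.Integrable
      (fun ω => afRate η Ps N₀ d₁ d₂ m α T (‖h₁ ω‖ ^ 2) (‖g ω‖ ^ 2) (‖f ω‖ ^ 2)) μ ∧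
    MeasureTheory.IntegrableOn
      (fun y : ℝ =>
        meijerG 1 4 ![0, 0, 1, 1] ![1, 0]
            ((k ^ 2 * Ps * ls * ld * y / (N₀ * d₁ ^ m * d₂ ^ m * (1 + k * y)) : ℝ) : ℂ) *
          ((Real.exp (-y / lr) : ℝ) : ℂ))
      (Set.Ioi 0) ∧
    ((afErgodicCapacity μ h₁ g f η Ps N₀ d₁ d₂ m α T : ℝ) : ℂ) =
      meijerG 1 4 ![0, 0, 1, 1] ![1, 0]
          ((k * Ps * ls * ld / (N₀ * d₁ ^ m * d₂ ^ m) : ℝ) : ℂ) / ((Real.log 2 : ℝ) : ℂ) -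
        1 / ((lr * Real.log 2 : ℝ) : ℂ) *
          ∫ y in Set.Ioi (0 : ℝ),
            meijerG 1 4 ![0, 0, 1, 1] ![1, 0]
                ((k ^ 2 * Ps * ls * ld * y / (N₀ * d₁ ^ m * d₂ ^ m * (1 + k * y)) : ℝ) : ℂ) *
              ((Real.exp (-y / lr) : ℝ) : ℂ) := by
  have h1α : 0 < 1 - α := by linarith
  have hk0 : 0 < k := by rw [hk]; positivity
  have hD₁ : 0 < d₁ ^ m := Real.rpow_pos_of_pos hd₁ m
  have hD₂ : 0 < d₂ ^ m := Real.rpow_pos_of_pos hd₂ m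
  have hlr' : 0 < 1 / lr := by positivity
  have hlog2 : 0 < Real.log 2 := Real.log_pos one_lt_two
  have := isProbabilityMeasure_expMeasure (one_div_pos.2 hls)
  have := isProbabilityMeasure_expMeasure (one_div_pos.2 hld)
  have := isProbabilityMeasure_expMeasure hlr'
  obtain ⟨A, hA⟩ : ∃ A, A = k * Ps / (N₀ * d₁ ^ m * d₂ ^ m) := ⟨_, rfl⟩
  have hA0 : 0 < A := by rw [hA]; positivity
  set ν := (expMeasure (1 / ls)).prod (expMeasure (1 / ld)) with hν
  set ρ := ν.prod (expMeasure (1 / lr)) with hρ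
  have hXm : Measurable fun ω => ‖h₁ ω‖ ^ 2 := by fun_prop
  have hYm : Measurable fun ω => ‖g ω‖ ^ 2 := by fun_prop
  have hZm : Measurable fun ω => ‖f ω‖ ^ 2 := by fun_prop
  have hmap : μ.map (fun ω => ((‖h₁ ω‖ ^ 2, ‖g ω‖ ^ 2), ‖f ω‖ ^ 2)) = ρ := by
    rw [map_triple_eq_prod_of_iIndepFun hXm hYm hZm indep, law_h₁, law_g, law_f]
  have hpos : ∀ᵐ q ∂ρ, (0 < q.1.1 ∧ 0 < q.1.2) ∧ 0 < q.2 :=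
    (Measure.quasiMeasurePreserving_fst.ae (ae_prod_expMeasure_pos _ _)).and
      (Measure.quasiMeasurePreserving_snd.ae (ae_expMeasure_pos _))
  set L₁ : (ℝ × ℝ) × ℝ → ℝ := fun q => Real.log (1 + A * (q.1.1 * q.1.2)) with hL₁
  set L₂ : (ℝ × ℝ) × ℝ → ℝ :=
    fun q => Real.log (1 + A * (k * q.2 / (1 + k * q.2)) * (q.1.1 * q.1.2)) with hL₂
  have hid : ∀ l : ℝ, 0 < l → Integrable (fun x : ℝ => x) (expMeasure (1 / l)) := fun l hl => by
    simpa using integrable_rpow_expMeasure (one_div_pos.2 hl) zero_le_one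
  have hW : Integrable (fun q : (ℝ × ℝ) × ℝ => A * (q.1.1 * q.1.2)) ρ :=
    ((hid ls hls).mul_prod (hid ld hld)).comp_fst _ |>.const_mul A
  have hL₁i : Integrable L₁ ρ := integrable_log_one_add hW
    (hpos.mono fun q hq => mul_nonneg hA0.le (mul_nonneg hq.1.1.le hq.1.2.le))
  have hL₂i : Integrable L₂ ρ := by
    refine integrable_log_one_add (hW.mono' (Measurable.aestronglyMeasurable (by fun_prop)) ?_) ?_
    · filter_upwards [hpos] with q ⟨⟨hq₁, hq₂⟩, hq₃⟩
      rw [Real.norm_of_nonneg (by positivity)]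
      refine mul_le_mul_of_nonneg_right (mul_le_of_le_one_right hA0.le ?_) (by positivity)
      exact (div_le_one (by positivity)).2 (by linarith)
    · filter_upwards [hpos] with q ⟨⟨hq₁, hq₂⟩, hq₃⟩
      positivity
  have hrate : (fun q : (ℝ × ℝ) × ℝ => afRate η Ps N₀ d₁ d₂ m α T q.1.1 q.1.2 q.2) =ᵐ[ρ]
      fun q => (L₁ q - L₂ q) / Real.log 2 := by
    filter_upwards [hpos] with q ⟨⟨hq₁, hq₂⟩, hq₃⟩
    exact afRate_eq hη hPs hN₀ hd₁ hd₂ hα₀ hα₁ hT hq₁ hq₂ hq₃ hk hA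
  have hratei : Integrable
      (fun q : (ℝ × ℝ) × ℝ => afRate η Ps N₀ d₁ d₂ m α T q.1.1 q.1.2 q.2) ρ :=
    ((hL₁i.sub hL₂i).div_const _).congr hrate.symm
  have hGm : Measurable (fun ω => ((‖h₁ ω‖ ^ 2, ‖g ω‖ ^ 2), ‖f ω‖ ^ 2)) := by fun_prop
  -- `F y` is the expectation of the second logarithm given that the loopback gain is `y`
  set F : ℝ → ℝ := fun y => ∫ p, L₂ (p, y) ∂ν with hF
  have hG₁ : meijerG 1 4 ![0, 0, 1, 1] ![1, 0]
      ((k * Ps * ls * ld / (N₀ * d₁ ^ m * d₂ ^ m) : ℝ) : ℂ) = ((∫ q, L₁ q ∂ρ : ℝ) : ℂ) := by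
    rw [show k * Ps * ls * ld / (N₀ * d₁ ^ m * d₂ ^ m) = A * ls * ld by rw [hA]; ring,
      meijerG_eq_integral_log hA0 hls hld, integral_prod _ hL₁i]
    simp only [hL₁, hν, integral_const, probReal_univ, one_smul]
  have hG₂ : ∀ y ∈ Ioi (0 : ℝ), meijerG 1 4 ![0, 0, 1, 1] ![1, 0]
      ((k ^ 2 * Ps * ls * ld * y / (N₀ * d₁ ^ m * d₂ ^ m * (1 + k * y)) : ℝ) : ℂ) *
        ((Real.exp (-y / lr) : ℝ) : ℂ) =
      ((lr * ((1 / lr * Real.exp (-(1 / lr * y))) • F y) : ℝ) : ℂ) := by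
    intro y hy
    have hy' : (0 : ℝ) < y := hy
    rw [show k ^ 2 * Ps * ls * ld * y / (N₀ * d₁ ^ m * d₂ ^ m * (1 + k * y)) =
        A * (k * y / (1 + k * y)) * ls * ld by rw [hA]; field_simp,
      meijerG_eq_integral_log (by positivity) hls hld, ← Complex.ofReal_mul,
      show -y / lr = -(1 / lr * y) by ring, smul_eq_mul]
    change ((F y * _ : ℝ) : ℂ) = _
    congr 1
    rw [mul_comm (F y), ← mul_assoc, ← mul_assoc, mul_one_div_cancel hlr.ne', one_mul]
  have hFi : Integrable F (expMeasure (1 / lr)) := hL₂i.integral_prod_right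
  refine ⟨fun x hx => meijerGWellDefined hx, ?_, ?_, ?_⟩
  · rw [← hmap] at hratei
    exact hratei.comp_measurable hGm
  · rw [integrableOn_congr_fun hG₂ measurableSet_Ioi]
    exact (((integrable_expMeasure_iff hlr'.le).1 hFi).const_mul lr).ofReal
  · rw [setIntegral_congr_fun measurableSet_Ioi hG₂, integral_complex_ofReal, integral_const_mul,
      ← integral_expMeasure hlr'.le, hG₁]
    have hcap : afErgodicCapacity μ h₁ g f η Ps N₀ d₁ d₂ m α T =
        (∫ q, L₁ q ∂ρ - ∫ y, F y ∂(expMeasure (1 / lr))) / Real.log 2 := by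
      rw [hF, ← integral_prod_symm _ hL₂i, ← integral_sub hL₁i hL₂i, ← integral_div,
        ← integral_congr_ae hrate, afErgodicCapacity, ← hmap]
      rw [← hmap] at hratei
      exact (integral_map hGm.aemeasurable hratei.aestronglyMeasurable).symm
    rw [hcap]
    have h1 : (lr : ℂ) ≠ 0 := by exact_mod_cast hlr.ne'
    have h2 : ((Real.log 2 : ℝ) : ℂ) ≠ 0 := by exact_mod_cast hlog2.ne'
    rw [Complex.ofReal_div, Complex.ofReal_sub, Complex.ofReal_mul, Complex.ofReal_mul]
    field_simp
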